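/- All graphs are finite, simple and undirected. For a connected graph $G$ with vertices $v_1,\dots,v_n$, the distance spectral radius $\rho(G)$ is the largest eigenvalue of the distance matrix $(d_G(v_i,v_j))_{i,j}$. A graph is $k$-chromatic if its chromatic number is $k$, and $k$-critical if it is $k$-chromatic and every proper subgraph has chromatic number less than $k$. Let $G$ be a graph that maximizes $\rho$ among all connected $k$-chromatic graphs of order $n$. Then $G$ has a $k$-critical subgraph $H$ such that $G$ is obtained from $H$ by attaching paths at vertices of $H$; that is, for each $v\in V(H)$ there is a path $P_v$ in $G$ (possibly trivial, i.e. of length $0$) having $v$ as an end vertex, such that $V(P_v)\cap V(H)=\{v\}$, the paths $P_v$ are pairwise vertex-disjoint, and $G=H\cup\bigcup_{v\in V(H)}P_v$. Moreover, $H$ and these paths can be chosen so that the set $S=\{v\in V(H): P_v \text{ has positive length}\}$ is an independent set of $H$. -/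

import Mathlib

universe u

namespace SimpleGraph

/-- The distance matrix of a graph. -/
noncomputable def distanceMatrix {V : Type u} (G : SimpleGraph V) : Matrix V V ℝ :=
  Matrix.of fun u v => (G.dist u v : ℝ)

/-- The distance spectral radius: the largest (real) eigenvalue of the distance matrix. -/
noncomputable def distanceSpectralRadius {V : Type u} [Fintype V] (G : SimpleGraph V) : ℝ :=
  sSup {μ : ℝ | Module.End.HasEigenvalue G.distanceMatrix.mulVecLin μ}

/-- The supremum in the definition is attained, so it is a genuine largest eigenvalue. -/
theorem isGreatest_distanceSpectralRadius {V : Type u} [Fintype V] [Nonempty V]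
    (G : SimpleGraph V) :
    IsGreatest {μ : ℝ | Module.End.HasEigenvalue G.distanceMatrix.mulVecLin μ}
      G.distanceSpectralRadius := by
  classical
  have hfin : {μ : ℝ | Module.End.HasEigenvalue G.distanceMatrix.mulVecLin μ}.Finite :=
    Module.End.finite_hasEigenvalue _
  have hD : G.distanceMatrix.IsHermitian := by
    ext u v
    simp [distanceMatrix, SimpleGraph.dist_comm]
  have hne : {μ : ℝ | Module.End.HasEigenvalue G.distanceMatrix.mulVecLin μ}.Nonempty := by
    obtain ⟨i⟩ := ‹Nonempty V›
    refine ⟨hD.eigenvalues i, ?_⟩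
    have h := hD.eigenvalues_mem_spectrum_real i
    rw [← Matrix.spectrum_toLin', ← Module.End.hasEigenvalue_iff_mem_spectrum] at h
    simpa [Matrix.toLin'_apply'] using h
  exact ⟨hne.csSup_mem hfin, fun μ hμ => le_csSup hfin.bddAbove hμ⟩

/-- Membership in the family of connected `k`-chromatic graphs of order `n`. -/
structure InChromaticFamily (k n : ℕ) {V : Type u} [Fintype V] (G : SimpleGraph V) : Prop where
  card_eq : Fintype.card V = n
  connected : G.Connected
  chromaticNumber_eq : G.chromaticNumber = (k : ℕ∞)

/-- `G` maximizes the distance spectral radius among all connected `k`-chromatic graphs of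
order `n`. -/
def MaximizesDistanceSpectralRadius (k n : ℕ) {V : Type u} [Fintype V]
    (G : SimpleGraph V) : Prop :=
  G.InChromaticFamily k n ∧
    ∀ (W : Type u) [Fintype W] (G' : SimpleGraph W), G'.InChromaticFamily k n →
      G'.distanceSpectralRadius ≤ G.distanceSpectralRadius

/-- A graph is `k`-critical if it is `k`-chromatic and every proper subgraph has a smaller
chromatic number. -/
def IsCritical (k : ℕ) {V : Type u} (G : SimpleGraph V) : Prop :=
  G.chromaticNumber = (k : ℕ∞) ∧
    ∀ K : G.Subgraph, K ≠ ⊤ → K.coe.chromaticNumber < (k : ℕ∞)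

/-- A presentation of `G` as obtained from its subgraph `H` by attaching a path (possibly of
length `0`) at each vertex `v` of `H`, with `v` an end vertex of the path: the path at `v` meets
`H` only in `v`, paths at distinct vertices are disjoint, and `G` is the union of `H` and all
the paths. -/
structure PathAttachment {V : Type u} {G : SimpleGraph V} (H : G.Subgraph) where
  endpoint : H.verts → V
  path : ∀ v : H.verts, G.Walk (v : V) (endpoint v)
  isPath : ∀ v, (path v).IsPath
  eq_of_mem : ∀ (v : H.verts) (x : V), x ∈ (path v).support → x ∈ H.verts → x = v
  disjoint : ∀ v w : H.verts, v ≠ w → List.Disjoint (path v).support (path w).support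
  union_eq : H ⊔ ⨆ v, (path v).toSubgraph = ⊤

/-- The vertices of `H` at which nontrivial paths (paths of positive length) are attached. -/
def PathAttachment.nontrivialVerts {V : Type u} {G : SimpleGraph V} {H : G.Subgraph}
    (A : PathAttachment H) : Set H.verts :=
  {v | 0 < (A.path v).length}

end SimpleGraph

/-!
Pairing the distance matrices of connected graphs on the same vertices with the Perron vector of
`G` shows that if the distances of `G` are at most the averages of the distances of two graphs
whose spectral radius is not larger, then they are equal to these averages. A maximizer `G` with a
`k`-critical subgraph `H` is compared in this way with graphs to which `H` still maps.

* Deleting an edge outside `H` that is not a bridge increases distances, so all edges outside `H`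
  are bridges.
* If a vertex `w` has three neighbors and two of the edges to them are outside `H`, then moving the
  branch behind one of these two edges from `w` to either of the other two neighbors does not
  decrease distances on average. Hence each vertex carries at most one branch and the branches are
  paths.
* If branches hang at both ends of an edge `uv` of `H`, the two branches and `uv` form a trunk, and
  sliding the rest of the graph one step along the trunk in either direction does not decrease
  distances on average. The distances from a third vertex of `H` to `u` and `v` increase, so there
  is no such vertex and `k = 2`; but then `H` can be chosen as an edge at a leaf of `G`.
-/

namespace DistanceSpectral

open SimpleGraph
open scoped Matrix

section Matrix

variable {V : Type*} [Fintype V] {A : Matrix V V ℝ} {c : ℝ}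

theorem posSemidef_smul_one_sub [DecidableEq V] (hA : A.IsHermitian)
    (hc : c ∈ upperBounds {μ | Module.End.HasEigenvalue A.mulVecLin μ}) :
    (c • (1 : Matrix V V ℝ) - A).PosSemidef := by
  rw [Matrix.posSemidef_iff_isHermitian_and_spectrum_nonneg]
  refine ⟨(Matrix.isHermitian_one.smul (.all c)).sub hA, fun μ hμ => ?_⟩
  rw [← Algebra.algebraMap_eq_smul_one, ← spectrum.singleton_sub_eq] at hμ
  obtain ⟨_, rfl, ν, hν, rfl⟩ := hμ
  rw [← Matrix.spectrum_toLin', ← Module.End.hasEigenvalue_iff_mem_spectrum,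
    Matrix.toLin'_apply'] at hν
  exact sub_nonneg.2 (hc hν)

theorem dotProduct_smul_one_sub_mulVec [DecidableEq V] (x : V → ℝ) :
    x ⬝ᵥ (c • (1 : Matrix V V ℝ) - A) *ᵥ x = c * x ⬝ᵥ x - x ⬝ᵥ A *ᵥ x := by
  rw [Matrix.sub_mulVec, Matrix.smul_mulVec, Matrix.one_mulVec, dotProduct_sub, dotProduct_smul,
    smul_eq_mul]

theorem dotProduct_mulVec_le (hA : A.IsHermitian)
    (hc : c ∈ upperBounds {μ | Module.End.HasEigenvalue A.mulVecLin μ}) (x : V → ℝ) :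
    x ⬝ᵥ A *ᵥ x ≤ c * x ⬝ᵥ x := by
  classical
  have h := (posSemidef_smul_one_sub hA hc).dotProduct_mulVec_nonneg x
  rw [star_trivial, dotProduct_smul_one_sub_mulVec] at h
  exact sub_nonneg.1 h

theorem mulVec_eq_smul_of_le_dotProduct_mulVec (hA : A.IsHermitian)
    (hc : c ∈ upperBounds {μ | Module.End.HasEigenvalue A.mulVecLin μ}) {x : V → ℝ}
    (hx : c * x ⬝ᵥ x ≤ x ⬝ᵥ A *ᵥ x) : A *ᵥ x = c • x := by
  classical
  have h := (posSemidef_smul_one_sub hA hc).dotProduct_mulVec_zero_iff x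
  rw [star_trivial, dotProduct_smul_one_sub_mulVec, sub_eq_zero,
    Matrix.sub_mulVec, Matrix.smul_mulVec, Matrix.one_mulVec, sub_eq_zero] at h
  exact (h.1 (hx.antisymm (dotProduct_mulVec_le hA hc x))).symm

theorem dotProduct_mulVec_le_abs (hA : ∀ i j, i ≠ j → 0 ≤ A i j) (x : V → ℝ) :
    x ⬝ᵥ A *ᵥ x ≤ |x| ⬝ᵥ A *ᵥ |x| := by
  simp only [dotProduct, Matrix.mulVec, Finset.mul_sum, Pi.abs_apply]
  refine Finset.sum_le_sum fun i _ => Finset.sum_le_sum fun j _ => ?_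
  obtain rfl | hij := eq_or_ne i j
  · exact le_of_eq (by linear_combination -A i i * abs_mul_abs_self (x i))
  · calc x i * (A i j * x j) = A i j * (x i * x j) := by ring
      _ ≤ A i j * |x i * x j| := mul_le_mul_of_nonneg_left (le_abs_self _) (hA i j hij)
      _ = |x i| * (A i j * |x j|) := by rw [abs_mul]; ring

theorem pos_of_mulVec_eq_smul (hA : ∀ i j, i ≠ j → 0 < A i j) {x : V → ℝ} (hx : 0 ≤ x)
    (hx₀ : x ≠ 0) (h : A *ᵥ x = c • x) (i : V) : 0 < x i := by
  refine (hx i).lt_of_ne' fun hi => hx₀ (funext fun j => ?_)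
  have hsum : ∑ j, A i j * x j = 0 := by
    simpa [Matrix.mulVec, dotProduct, hi] using congrFun h i
  have hterm : ∀ j ∈ Finset.univ, 0 ≤ A i j * x j := fun j _ => by
    obtain rfl | hij := eq_or_ne i j
    · simp [hi]
    · exact mul_nonneg (hA i j hij).le (hx j)
  obtain rfl | hij := eq_or_ne i j
  · exact hi
  · exact (mul_eq_zero.1 ((Finset.sum_eq_zero_iff_of_nonneg hterm).1 hsum j
      (Finset.mem_univ j))).resolve_left (hA i j hij).ne'

theorem exists_pos_mulVec_eq_smul (hA : A.IsHermitian) (hpos : ∀ i j, i ≠ j → 0 < A i j)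
    (hc : IsGreatest {μ | Module.End.HasEigenvalue A.mulVecLin μ} c) :
    ∃ x : V → ℝ, (∀ i, 0 < x i) ∧ A *ᵥ x = c • x := by
  obtain ⟨y, hy, hy₀⟩ := hc.1.exists_hasEigenvector
  rw [Module.End.mem_eigenspace_iff, Matrix.mulVecLin_apply] at hy
  have habs : A *ᵥ |y| = c • |y| := by
    refine mulVec_eq_smul_of_le_dotProduct_mulVec hA hc.2 ?_
    calc c * |y| ⬝ᵥ |y| = y ⬝ᵥ A *ᵥ y := by
          rw [hy, dotProduct_smul, smul_eq_mul]
          simp [dotProduct]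
      _ ≤ |y| ⬝ᵥ A *ᵥ |y| := dotProduct_mulVec_le_abs (fun i j hij => (hpos i j hij).le) y
  exact ⟨|y|, pos_of_mulVec_eq_smul hpos (abs_nonneg y) (mt (Pi.abs_eq_zero y).1 hy₀) habs, habs⟩

theorem eq_zero_of_dotProduct_mulVec_nonpos (hA : ∀ i j, 0 ≤ A i j) {x : V → ℝ}
    (hx : ∀ i, 0 < x i) (h : x ⬝ᵥ A *ᵥ x ≤ 0) : A = 0 := by
  simp only [dotProduct, Matrix.mulVec, Finset.mul_sum] at h
  have hterm : ∀ i j, 0 ≤ x i * (A i j * x j) := fun i j =>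
    mul_nonneg (hx i).le (mul_nonneg (hA i j) (hx j).le)
  have hrow : ∀ i ∈ Finset.univ, 0 ≤ ∑ j, x i * (A i j * x j) := fun i _ =>
    Finset.sum_nonneg fun j _ => hterm i j
  ext i j
  have hi := (Finset.sum_eq_zero_iff_of_nonneg hrow).1 (h.antisymm (Finset.sum_nonneg hrow)) i
    (Finset.mem_univ i)
  have hij := (Finset.sum_eq_zero_iff_of_nonneg fun j _ => hterm i j).1 hi j (Finset.mem_univ j)
  simpa [(hx i).ne', (hx j).ne'] using hij

end Matrix

section SpectralRadius

variable {V : Type*} {G G₁ G₂ : SimpleGraph V}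

theorem isHermitian_distanceMatrix (G : SimpleGraph V) : G.distanceMatrix.IsHermitian := by
  ext u v
  simp [distanceMatrix, SimpleGraph.dist_comm]

theorem two_mul_dist_eq [Fintype V] (hG : G.Connected)
    (h₁ : G₁.distanceSpectralRadius ≤ G.distanceSpectralRadius)
    (h₂ : G₂.distanceSpectralRadius ≤ G.distanceSpectralRadius)
    (hle : ∀ i j, 2 * G.dist i j ≤ G₁.dist i j + G₂.dist i j) (i j : V) :
    2 * G.dist i j = G₁.dist i j + G₂.dist i j := by
  have := hG.nonempty
  obtain ⟨x, hx, hGx⟩ := exists_pos_mulVec_eq_smul (isHermitian_distanceMatrix G)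
    (fun i j hij => Nat.cast_pos.2 (hG.pos_dist_of_ne hij)) G.isGreatest_distanceSpectralRadius
  -- Compare the three Rayleigh quotients at the Perron vector of `G`.
  have hrayleigh : ∀ {G' : SimpleGraph V},
      G'.distanceSpectralRadius ≤ G.distanceSpectralRadius →
        x ⬝ᵥ G'.distanceMatrix *ᵥ x ≤ G.distanceSpectralRadius * x ⬝ᵥ x := fun {G'} h =>
    (dotProduct_mulVec_le (isHermitian_distanceMatrix G')
      G'.isGreatest_distanceSpectralRadius.2 x).trans
        (mul_le_mul_of_nonneg_right h (dotProduct_self_star_nonneg x))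
  have hzero : G₁.distanceMatrix + G₂.distanceMatrix - (2 : ℝ) • G.distanceMatrix = 0 := by
    refine eq_zero_of_dotProduct_mulVec_nonpos (fun i j => sub_nonneg.2 ?_) hx ?_
    · simp only [Matrix.smul_apply, Matrix.add_apply, distanceMatrix, Matrix.of_apply, smul_eq_mul]
      exact_mod_cast hle i j
    · rw [Matrix.sub_mulVec, Matrix.add_mulVec, Matrix.smul_mulVec, hGx, dotProduct_sub,
        dotProduct_add, dotProduct_smul, dotProduct_smul, smul_eq_mul, smul_eq_mul]
      linarith [hrayleigh h₁, hrayleigh h₂]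
  have hij := congrFun (congrFun hzero i) j
  simp only [Matrix.sub_apply, Matrix.smul_apply, Matrix.add_apply, distanceMatrix,
    Matrix.of_apply, smul_eq_mul, Matrix.zero_apply] at hij
  exact_mod_cast (sub_eq_zero.1 hij).symm

end SpectralRadius

section Maps

variable {V W : Type*} {G : SimpleGraph V} {G' : SimpleGraph W}

theorem reachable_of_forall_adj {f : V → W}
    (hf : ∀ ⦃a b⦄, G.Adj a b → G'.Reachable (f a) (f b)) {a b : V} (h : G.Reachable a b) :
    G'.Reachable (f a) (f b) := by
  obtain ⟨p⟩ := h
  induction p with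
  | nil => rfl
  | cons hadj _ ih => exact (hf hadj).trans ih

theorem exists_walk_length_le {f : V → W}
    (hf : ∀ ⦃a b⦄, G.Adj a b → f a = f b ∨ G'.Adj (f a) (f b)) {a b : V} (p : G.Walk a b) :
    ∃ q : G'.Walk (f a) (f b), q.length ≤ p.length := by
  induction p with
  | nil => exact ⟨.nil, le_rfl⟩
  | cons hadj _ ih =>
    obtain ⟨q, hq⟩ := ih
    rcases hf hadj with heq | hadj'
    · exact ⟨q.copy heq.symm rfl, by simpa using hq.trans (Nat.le_succ _)⟩
    · exact ⟨.cons hadj' q, by simpa using hq⟩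

theorem dist_map_le {f : V → W} (hf : ∀ ⦃a b⦄, G.Adj a b → f a = f b ∨ G'.Adj (f a) (f b))
    {a b : V} (h : G.Reachable a b) : G'.dist (f a) (f b) ≤ G.dist a b := by
  obtain ⟨p, hp⟩ := h.exists_walk_length_eq_dist
  obtain ⟨q, hq⟩ := exists_walk_length_le hf p
  exact (dist_le q).trans (hq.trans_eq hp)

end Maps

section BridgeSide

variable {V : Type*} {G G' : SimpleGraph V} {B C S : Set V} {b c i j u v w x : V}

/-- Every edge of `G` leaving the vertex set `S` does so from the vertex `x` of `S`. -/
structure IsAttachedAt (G : SimpleGraph V) (S : Set V) (x : V) : Prop where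
  mem : x ∈ S
  eq_of_adj : ∀ ⦃a⦄, a ∈ S → ∀ ⦃c⦄, c ∉ S → G.Adj a c → a = x

theorem IsAttachedAt.dist_eq (hS : IsAttachedAt G S x) (hG : G.Connected) (hi : i ∈ S)
    (hj : j ∉ S) : G.dist i j = G.dist i x + G.dist x j := by
  refine le_antisymm hG.dist_triangle ?_
  obtain ⟨p, hp⟩ := hG.exists_walk_length_eq_dist i j
  obtain ⟨d, hd, hfst, hsnd⟩ := p.exists_boundary_dart S hi hj
  have hx : x ∈ p.support := hS.eq_of_adj hfst hsnd d.adj ▸ p.dart_fst_mem_support_of_mem_darts hd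
  classical
  calc G.dist i x + G.dist x j ≤ (p.takeUntil x hx).length + (p.dropUntil x hx).length :=
        add_le_add (dist_le _) (dist_le _)
    _ = G.dist i j := by rw [← Walk.length_append, p.take_spec hx, hp]

theorem IsAttachedAt.dist_le_dist (hS : IsAttachedAt G' S x) (hG' : G'.Connected)
    (hle : ∀ ⦃a⦄, a ∈ S → ∀ ⦃c⦄, c ∈ S → G'.Adj a c → G.Adj a c) (hi : i ∈ S) (hj : j ∈ S) :
    G.dist i j ≤ G'.dist i j := by
  classical
  have h := dist_map_le (G' := G) (f := fun a => if a ∈ S then a else x) (fun a c hac => ?_)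
    (hG' i j)
  · simpa only [if_pos hi, if_pos hj] using h
  · by_cases ha : a ∈ S <;> by_cases hc : c ∈ S <;> simp only [ha, hc, if_true, if_false]
    · exact .inr (hle ha hc hac)
    · exact .inl (hS.eq_of_adj ha hc hac)
    · exact .inl (hS.eq_of_adj hc ha hac.symm).symm
    · exact .inl trivial

/-- `B` is the side containing `b` of a bridge `wb` of `G`: the edge `wb` is the only one between
`B` and its complement. -/
structure IsBridgeSide (G : SimpleGraph V) (B : Set V) (w b : V) : Prop where
  adj : G.Adj w b
  inside : IsAttachedAt G B b
  outside : IsAttachedAt G Bᶜ w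

namespace IsBridgeSide

theorem mem (h : IsBridgeSide G B w b) : b ∈ B :=
  h.inside.mem

theorem notMem (h : IsBridgeSide G B w b) : w ∉ B :=
  h.outside.mem

theorem symm (h : IsBridgeSide G B w b) : IsBridgeSide G Bᶜ b w :=
  ⟨h.adj.symm, h.outside, (compl_compl B).symm ▸ h.inside⟩

theorem eq_of_adj (h : IsBridgeSide G B w b) {a c : V} (ha : a ∈ B) (hc : c ∉ B)
    (hac : G.Adj a c) : a = b ∧ c = w :=
  ⟨h.inside.eq_of_adj ha hc hac, h.outside.eq_of_adj hc (not_not.2 ha) hac.symm⟩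

theorem dist_eq (h : IsBridgeSide G B w b) (hG : G.Connected) (hi : i ∈ B) (hj : j ∉ B) :
    G.dist i j = G.dist i b + 1 + G.dist w j := by
  rw [h.inside.dist_eq hG hi hj, dist_comm (u := b), h.outside.dist_eq hG hj (not_not.2 h.mem),
    dist_eq_one_iff_adj.2 h.adj, dist_comm (u := j)]
  ring

theorem two_mul_dist_le (h : IsBridgeSide G B w b) (hG : G.Connected) (hc : G.Adj w c)
    (hcb : c ≠ b) (j : V) : 2 * G.dist w j ≤ G.dist b j + G.dist c j := by
  have hcw : G.dist w c = 1 := dist_eq_one_iff_adj.2 hc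
  by_cases hj : j ∈ B
  · have hcB : c ∉ B := fun hcB => hcb (h.eq_of_adj hcB h.notMem hc.symm).1
    have hw := h.dist_eq hG hj h.notMem
    have hc := h.dist_eq hG hj hcB
    rw [dist_self] at hw
    rw [dist_comm (u := w), dist_comm (u := b), dist_comm (u := c)]
    omega
  · have hb := h.dist_eq hG h.mem hj
    have htri : G.dist w j ≤ G.dist w c + G.dist c j := hG.dist_triangle
    rw [dist_self] at hb
    omega

theorem disjoint (hB : IsBridgeSide G B u b) (hC : IsBridgeSide G C v c) (hG : G.Connected)
    (hvB : v ∉ B) (huC : u ∉ C) (huv : u ≠ v) : Disjoint B C := by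
  refine Set.disjoint_left.2 fun a haB haC => ?_
  obtain ⟨p⟩ := hG a u
  obtain ⟨d, -, ⟨hfB, hfC⟩, hsnd⟩ := p.exists_boundary_dart (B ∩ C) ⟨haB, haC⟩
    fun h => hB.notMem h.1
  have hsB : d.snd ∉ B := fun hsB =>
    hvB ((hC.eq_of_adj hfC (fun hsC => hsnd ⟨hsB, hsC⟩) d.adj).2 ▸ hsB)
  have hsu : d.snd = u := (hB.eq_of_adj hfB hsB d.adj).2
  exact huv (hsu.symm.trans (hC.eq_of_adj hfC (hsu ▸ huC) d.adj).2)

theorem notMem_of_mem_verts (h : IsBridgeSide G B w b) {H : G.Subgraph} (hH : H.Connected)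
    (hw : w ∈ H.verts) (hwb : ¬H.Adj w b) (hx : x ∈ H.verts) : x ∉ B := fun hxB => by
  obtain ⟨p⟩ := hH.coe ⟨x, hx⟩ ⟨w, hw⟩
  obtain ⟨d, -, hfst, hsnd⟩ := p.exists_boundary_dart {y | (y : V) ∈ B} hxB h.notMem
  have hd : H.Adj d.fst d.snd := d.adj
  obtain ⟨hf, hs⟩ := h.eq_of_adj hfst hsnd hd.adj_sub
  exact hwb (hs ▸ hf ▸ hd.symm)

theorem exists_coloring {α : Type*} (h : IsBridgeSide G B w b) {γ : V → α} {e : α}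
    (hγ : ∀ ⦃a c⦄, (a ∈ B ↔ c ∈ B) → G.Adj a c → γ a ≠ γ c) (he : e ≠ γ w) :
    ∃ δ : G.Coloring α, δ b = e ∧ ∀ a ∉ B, δ a = γ a := by
  classical
  refine ⟨Coloring.mk (fun a => if a ∈ B then Equiv.swap (γ b) e (γ a) else γ a)
    fun {a c} hac => ?_, ?_, fun a ha => if_neg ha⟩
  · by_cases ha : a ∈ B <;> by_cases hc : c ∈ B <;> simp only [ha, hc, if_true, if_false]
    · exact (Equiv.swap _ _).injective.ne (hγ (iff_of_true ha hc) hac)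
    · obtain ⟨rfl, rfl⟩ := h.eq_of_adj ha hc hac
      rwa [Equiv.swap_apply_left]
    · obtain ⟨rfl, rfl⟩ := h.eq_of_adj hc ha hac.symm
      rwa [Equiv.swap_apply_left, ne_comm]
    · exact hγ (iff_of_false ha hc) hac
  · exact (if_pos h.mem).trans (Equiv.swap_apply_left _ _)

end IsBridgeSide

theorem exists_isBridgeSide (hwb : G.Adj w b) (hbr : G.IsBridge s(w, b)) :
    ∃ B, IsBridgeSide G B w b := by
  set G' := G.deleteEdges {s(w, b)}
  have hw : ¬G'.Reachable w b := isBridge_iff.1 hbr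
  have hedge : ∀ {a c}, G'.Reachable a b → ¬G'.Reachable c b → G.Adj a c → a = b ∧ c = w := by
    intro a c ha hc hac
    have hac' : s(a, c) = s(w, b) := by
      by_contra hne
      exact hc ((deleteEdges_adj.2 ⟨hac, hne⟩ : G'.Adj a c).symm.reachable.trans ha)
    rcases Sym2.eq_iff.1 hac' with ⟨rfl, -⟩ | h
    · exact absurd ha hw
    · exact h
  exact ⟨{a | G'.Reachable a b}, hwb,
    ⟨Reachable.rfl, fun a ha c hc hac => (hedge ha hc hac).1⟩,
    ⟨hw, fun a ha c hc hac => (hedge (not_not.1 hc) ha hac.symm).2⟩⟩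

end BridgeSide

section MoveBranch

variable {V : Type*} {G : SimpleGraph V} {B : Set V} {a b c i j w w' : V} {k : ℕ}

/-- The graph `G` with its edge `wb` replaced by `w'b`; if `wb` is a bridge, this moves the branch
containing `b` from `w` to `w'`. -/
def moveBranch (G : SimpleGraph V) (w b w' : V) : SimpleGraph V :=
  G.deleteEdges {s(w, b)} ⊔ edge w' b

namespace IsBridgeSide

theorem moveBranch_adj_iff (h : IsBridgeSide G B w b) (hw' : w' ∉ B) (hac : a ∈ B ↔ c ∈ B) :
    (moveBranch G w b w').Adj a c ↔ G.Adj a c := by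
  have hb := h.mem
  have hw := h.notMem
  simp only [moveBranch, sup_adj, deleteEdges_adj, Set.mem_singleton_iff, edge_adj, Sym2.eq_iff]
  grind

theorem isBridgeSide_moveBranch (h : IsBridgeSide G B w b) (hw' : w' ∉ B) :
    IsBridgeSide (moveBranch G w b w') B w' b := by
  have hb := h.mem
  have hcross : ∀ ⦃a⦄, a ∈ B → ∀ ⦃c⦄, c ∉ B → (moveBranch G w b w').Adj a c →
      a = b ∧ c = w' := by
    intro a ha c hc hac
    rw [moveBranch, sup_adj, deleteEdges_adj, edge_adj] at hac
    rcases hac with ⟨hac, hne⟩ | ⟨⟨rfl, -⟩ | hac, -⟩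
    · obtain ⟨rfl, rfl⟩ := h.eq_of_adj ha hc hac
      exact absurd Sym2.eq_swap hne
    · exact absurd ha hw'
    · exact hac
  refine ⟨.inr ?_, ⟨hb, fun a ha c hc hac => (hcross ha hc hac).1⟩,
    ⟨hw', fun a ha c hc hac => (hcross (not_not.1 hc) ha hac.symm).2⟩⟩
  rw [edge_adj]
  exact ⟨.inl ⟨rfl, rfl⟩, (ne_of_mem_of_not_mem hb hw').symm⟩

theorem connected_moveBranch (h : IsBridgeSide G B w b) (hG : G.Connected) (hw' : w' ∉ B) :
    (moveBranch G w b w').Connected := by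
  classical
  set G' := moveBranch G w b w'
  have hww' : G'.Reachable w w' := by
    have hretract := reachable_of_forall_adj (G' := G') (f := fun a => if a ∈ B then w else a)
      (fun a c hac => ?_) (hG w w')
    · simpa only [h.notMem, hw', if_false] using hretract
    · by_cases ha : a ∈ B <;> by_cases hc : c ∈ B <;> simp only [ha, hc, if_true, if_false]
      · rfl
      · rw [(h.eq_of_adj ha hc hac).2]
      · rw [(h.eq_of_adj hc ha hac.symm).2]
      · exact ((h.moveBranch_adj_iff hw' (by tauto)).2 hac).reachable
  have hwb : G'.Reachable w b := hww'.trans (h.isBridgeSide_moveBranch hw').adj.reachable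
  have := hG.nonempty
  refine ⟨fun i j => reachable_of_forall_adj (f := id) (fun a c hac => ?_) (hG i j)⟩
  by_cases ha : a ∈ B <;> by_cases hc : c ∈ B
  · exact ((h.moveBranch_adj_iff hw' (by tauto)).2 hac).reachable
  · obtain ⟨rfl, rfl⟩ := h.eq_of_adj ha hc hac
    exact hwb.symm
  · obtain ⟨rfl, rfl⟩ := h.eq_of_adj hc ha hac.symm
    exact hwb
  · exact ((h.moveBranch_adj_iff hw' (by tauto)).2 hac).reachable

theorem colorable_moveBranch (h : IsBridgeSide G B w b) (hw' : w' ∉ B) (hG : G.Colorable k) :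
    (moveBranch G w b w').Colorable k := by
  obtain ⟨γ⟩ := hG
  obtain ⟨e, he⟩ : ∃ e, e ≠ γ w' := by
    by_cases hw : γ w = γ w'
    · exact ⟨γ b, fun hb => γ.valid h.adj (hw.trans hb.symm)⟩
    · exact ⟨γ w, hw⟩
  obtain ⟨δ, -⟩ := (h.isBridgeSide_moveBranch hw').exists_coloring
    (fun a c hiff hac => γ.valid ((h.moveBranch_adj_iff hw' hiff).1 hac)) he
  exact ⟨δ⟩

theorem dist_le_dist_moveBranch (h : IsBridgeSide G B w b) (hG : G.Connected) (hw' : w' ∉ B)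
    (hij : i ∈ B ↔ j ∈ B) : G.dist i j ≤ (moveBranch G w b w').dist i j := by
  have h' := h.isBridgeSide_moveBranch hw'
  have hG' := h.connected_moveBranch hG hw'
  by_cases hi : i ∈ B
  · exact h'.inside.dist_le_dist hG'
      (fun a ha c hc => (h.moveBranch_adj_iff hw' (iff_of_true ha hc)).1) hi (hij.1 hi)
  · exact h'.outside.dist_le_dist hG'
      (fun a ha c hc => (h.moveBranch_adj_iff hw' (iff_of_false ha hc)).1) hi (mt hij.2 hi)

theorem dist_add_one_add_dist_le_moveBranch (h : IsBridgeSide G B w b) (hG : G.Connected)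
    (hw' : w' ∉ B) (hi : i ∈ B) (hj : j ∉ B) :
    G.dist i b + 1 + G.dist w' j ≤ (moveBranch G w b w').dist i j := by
  rw [(h.isBridgeSide_moveBranch hw').dist_eq (h.connected_moveBranch hG hw') hi hj]
  have hib := h.dist_le_dist_moveBranch hG hw' (iff_of_true hi h.mem)
  have hwj := h.dist_le_dist_moveBranch hG hw' (iff_of_false hw' hj)
  omega

theorem two_mul_dist_le_moveBranch {C : Set V} {d : V} (hB : IsBridgeSide G B w b)
    (hC : IsBridgeSide G C w c) (hG : G.Connected) (hd : G.Adj w d) (hcb : c ≠ b) (hdb : d ≠ b)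
    (hdc : d ≠ c) (i j : V) :
    2 * G.dist i j ≤ (moveBranch G w b c).dist i j + (moveBranch G w b d).dist i j := by
  have hcB : c ∉ B := fun h => hcb (hB.eq_of_adj h hB.notMem hC.adj.symm).1
  have hdB : d ∉ B := fun h => hdb (hB.eq_of_adj h hB.notMem hd.symm).1
  wlog hle : i ∈ B ∨ j ∉ B generalizing i j
  · have hji := this j i (by tauto)
    rwa [dist_comm, (moveBranch G w b c).dist_comm, (moveBranch G w b d).dist_comm] at hji
  by_cases hij : i ∈ B ↔ j ∈ B
  · have hc := hB.dist_le_dist_moveBranch hG hcB hij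
    have hd := hB.dist_le_dist_moveBranch hG hdB hij
    omega
  · obtain ⟨hi, hj⟩ : i ∈ B ∧ j ∉ B := by tauto
    have hdist := hB.dist_eq hG hi hj
    have hc := hB.dist_add_one_add_dist_le_moveBranch hG hcB hi hj
    have hd' := hB.dist_add_one_add_dist_le_moveBranch hG hdB hi hj
    have hconvex := hC.two_mul_dist_le hG hd hdc j
    omega

theorem dist_lt_dist_moveBranch (hB : IsBridgeSide G B w b) (hG : G.Connected) (hw' : w' ∉ B)
    (hne : w' ≠ w) : G.dist b w < (moveBranch G w b w').dist b w := by
  have hle := hB.dist_add_one_add_dist_le_moveBranch hG hw' hB.mem hB.notMem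
  have hpos := hG.pos_dist_of_ne hne
  rw [dist_eq_one_iff_adj.2 hB.adj.symm]
  omega

end IsBridgeSide

end MoveBranch

section Slide

variable {V : Type*} {G : SimpleGraph V} {k : ℕ} {a c i j z : V}

/-- An edge `uv` of `G` at both of whose ends a branch hangs by a bridge: the branch `B` by `uu'`
and the branch `C` by `vv'`. -/
structure BranchPair (G : SimpleGraph V) where
  (u v u' v' : V)
  (B C : Set V)
  left : IsBridgeSide G B u u'
  right : IsBridgeSide G C v v'
  adj : G.Adj u v
  right_notMem : v ∉ B
  left_notMem : u ∉ C
  disjoint : Disjoint B C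

namespace BranchPair

/-- The branch pair with its two ends interchanged. -/
def symm (P : BranchPair G) : BranchPair G where
  u := P.v
  v := P.u
  u' := P.v'
  v' := P.u'
  B := P.C
  C := P.B
  left := P.right
  right := P.left
  adj := P.adj.symm
  right_notMem := P.left_notMem
  left_notMem := P.right_notMem
  disjoint := P.disjoint.symm

variable (P : BranchPair G)

/-- The vertices outside the trunk, which consists of the edge `uv` and the two branches. -/
def core : Set V := {z | z ∉ P.B ∧ z ∉ P.C ∧ z ≠ P.u ∧ z ≠ P.v}

theorem core_symm : P.symm.core = P.core := by
  ext z
  simp only [core, symm, Set.mem_ofPred_eq]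
  tauto

theorem u_notMem_core : P.u ∉ P.core := fun h => h.2.2.1 rfl

theorem v_notMem_core : P.v ∉ P.core := fun h => h.2.2.2 rfl

theorem notMem_core_of_mem_B (ha : a ∈ P.B) : a ∉ P.core := fun h => h.1 ha

theorem notMem_core_of_mem_insert (ha : a ∈ insert P.v P.C) : a ∉ P.core :=
  fun h => ha.elim h.2.2.2 h.2.1

theorem notMem_of_mem_insert (ha : a ∈ insert P.v P.C) : a ∉ P.B :=
  ha.elim (fun h => h ▸ P.right_notMem) fun h hB => Set.disjoint_left.1 P.disjoint hB h

theorem u_notMem_insert : P.u ∉ insert P.v P.C :=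
  fun h => h.elim P.adj.ne P.left_notMem

theorem eq_or_eq_of_adj_core (ha : a ∉ P.core) (hc : c ∈ P.core) (hac : G.Adj a c) :
    a = P.u ∨ a = P.v := by
  by_contra! hne
  have haB : a ∉ P.B := fun haB => hc.2.2.1 (P.left.eq_of_adj haB hc.1 hac).2
  have haC : a ∉ P.C := fun haC => hc.2.2.2 (P.right.eq_of_adj haC hc.2.1 hac).2
  exact ha ⟨haB, haC, hne⟩

theorem notMem_of_adj_core (hc : c ∈ P.core) (hac : G.Adj a c) : a ∉ P.B ∧ a ∉ P.C := by
  by_cases ha : a ∈ P.core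
  · exact ⟨ha.1, ha.2.1⟩
  · rcases P.eq_or_eq_of_adj_core ha hc hac with rfl | rfl
    · exact ⟨P.left.notMem, P.left_notMem⟩
    · exact ⟨P.right_notMem, P.right.notMem⟩

open Classical in
/-- The map collapsing `G` onto the core and the edge `u'u`, with `v` sent to `u` and `u` sent to
`u'`. -/
noncomputable def shift (a : V) : V :=
  if a ∈ P.core then a else if a ∈ insert P.u P.B then P.u' else P.u

open Classical in
/-- The map collapsing the slid graph onto the core and the edge `uv`, with `u'` sent to `u` and
`u` to `v`. -/
noncomputable def fold (a : V) : V :=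
  if a ∈ P.core then a else if a ∈ P.B then P.u else P.v

theorem shift_of_mem_core (ha : a ∈ P.core) : P.shift a = a := if_pos ha

theorem shift_eq_or_eq (ha : a ∉ P.core) : P.shift a = P.u' ∨ P.shift a = P.u := by
  rw [shift, if_neg ha]
  split_ifs
  exacts [.inl rfl, .inr rfl]

theorem shift_u : P.shift P.u = P.u' := by
  rw [shift, if_neg P.u_notMem_core, if_pos (.inl rfl)]

theorem shift_v : P.shift P.v = P.u := by
  have hv : P.v ∉ insert P.u P.B := fun h => h.elim P.adj.ne' P.right_notMem
  rw [shift, if_neg P.v_notMem_core, if_neg hv]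

theorem fold_of_mem_core (ha : a ∈ P.core) : P.fold a = a := if_pos ha

theorem fold_of_mem_B (ha : a ∈ P.B) : P.fold a = P.u := by
  rw [fold, if_neg (P.notMem_core_of_mem_B ha), if_pos ha]

theorem fold_u : P.fold P.u = P.v := by
  rw [fold, if_neg P.u_notMem_core, if_neg P.left.notMem]

theorem fold_eq_or_eq (ha : a ∉ P.core) : P.fold a = P.u ∨ P.fold a = P.v := by
  rw [fold, if_neg ha]
  split_ifs
  exacts [.inl rfl, .inr rfl]

theorem shift_mem (a : V) : P.shift a ∈ insert P.u (insert P.u' P.core) := by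
  by_cases ha : a ∈ P.core
  · rw [P.shift_of_mem_core ha]
    exact .inr (.inr ha)
  · rcases P.shift_eq_or_eq ha with h | h <;> simp [h]

theorem fold_shift (haB : a ∉ P.B) (haC : a ∉ P.C) : P.fold (P.shift a) = a := by
  by_cases ha : a ∈ P.core
  · rw [P.shift_of_mem_core ha, P.fold_of_mem_core ha]
  · obtain rfl | rfl : a = P.u ∨ a = P.v := by
      by_contra! hne
      exact ha ⟨haB, haC, hne⟩
    · rw [P.shift_u, P.fold_of_mem_B P.left.mem]
    · rw [P.shift_v, P.fold_u]

/-- The graph obtained by sliding the core one step along the trunk: the edges from the core to `u`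
and `v` are replaced by edges to `u'` and `u`. -/
def slide : SimpleGraph V where
  Adj a c := a ∉ P.core ∧ c ∉ P.core ∧ G.Adj a c ∨
    a ∈ insert P.u (insert P.u' P.core) ∧ c ∈ insert P.u (insert P.u' P.core) ∧
      G.Adj (P.fold a) (P.fold c)
  symm := ⟨fun _ _ h => h.imp (fun h => ⟨h.2.1, h.1, h.2.2.symm⟩) fun h => ⟨h.2.1, h.1, h.2.2.symm⟩⟩
  loopless := ⟨fun _ h => h.elim (fun h => h.2.2.ne rfl) fun h => h.2.2.ne rfl⟩

theorem slide_adj_shift (haB : a ∉ P.B) (haC : a ∉ P.C) (hcB : c ∉ P.B) (hcC : c ∉ P.C)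
    (hac : G.Adj a c) : P.slide.Adj (P.shift a) (P.shift c) :=
  .inr ⟨P.shift_mem a, P.shift_mem c, by rwa [P.fold_shift haB haC, P.fold_shift hcB hcC]⟩

theorem slide_adj_u_u' : P.slide.Adj P.u P.u' :=
  .inl ⟨P.u_notMem_core, P.notMem_core_of_mem_B P.left.mem, P.left.adj⟩

theorem slide_adj_u_v : P.slide.Adj P.u P.v :=
  .inl ⟨P.u_notMem_core, P.v_notMem_core, P.adj⟩

theorem isAttachedAt_slide : IsAttachedAt P.slide P.B P.u' := by
  refine ⟨P.left.mem, fun a ha c hc hac => ?_⟩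
  rcases hac with ⟨-, -, hac⟩ | ⟨rfl | rfl | ha', -, -⟩
  · exact P.left.inside.eq_of_adj ha hc hac
  · exact absurd ha P.left.notMem
  · rfl
  · exact absurd ha ha'.1

theorem isBridgeSide_slide : IsBridgeSide P.slide (insert P.v P.C) P.u P.v := by
  have hcross : ∀ ⦃a⦄, a ∈ insert P.v P.C → ∀ ⦃c⦄, c ∉ insert P.v P.C → P.slide.Adj a c →
      a = P.v ∧ c = P.u := by
    intro a ha c hc hac
    rcases hac with ⟨-, hc', hac⟩ | ⟨rfl | rfl | ha', -, -⟩
    · obtain rfl | haC := ha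
      · have hcu : c = P.u := by
          by_contra hcu
          have hcB : c ∈ P.B := not_not.1 fun hcB =>
            hc' ⟨hcB, mt .inr hc, hcu, mt .inl hc⟩
          exact P.adj.ne (P.left.eq_of_adj hcB P.right_notMem hac.symm).2.symm
        exact ⟨rfl, hcu⟩
      · exact absurd (.inl (P.right.eq_of_adj haC (mt .inr hc) hac).2) hc
    · exact absurd ha P.u_notMem_insert
    · exact absurd P.left.mem (P.notMem_of_mem_insert ha)
    · exact absurd ha' (P.notMem_core_of_mem_insert ha)
  exact ⟨P.slide_adj_u_v, ⟨.inl rfl, fun a ha c hc hac => (hcross ha hc hac).1⟩,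
    ⟨P.u_notMem_insert, fun a ha c hc hac => (hcross (not_not.1 hc) ha hac.symm).2⟩⟩

theorem connected_slide (hG : G.Connected) : P.slide.Connected := by
  classical
  have huv := P.slide_adj_u_v.reachable
  have huu' := P.slide_adj_u_u'.reachable
  have htrunk : ∀ a ∉ P.core, P.slide.Reachable P.u a := by
    intro a ha
    have h := reachable_of_forall_adj (G' := P.slide)
      (f := fun a => if a ∈ P.core then P.u else a) (fun a c hac => ?_) (hG P.u a)
    · simpa only [if_neg P.u_notMem_core, if_neg ha] using h
    · by_cases ha : a ∈ P.core <;> by_cases hc : c ∈ P.core <;>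
        simp only [ha, hc, if_true, if_false]
      · rfl
      · rcases P.eq_or_eq_of_adj_core hc ha hac.symm with rfl | rfl
        exacts [.rfl, huv]
      · rcases P.eq_or_eq_of_adj_core ha hc hac with rfl | rfl
        exacts [.rfl, huv.symm]
      · exact Adj.reachable (.inl ⟨ha, hc, hac⟩)
  have hshift : ∀ a c, P.slide.Reachable (P.shift a) (P.shift c) := fun a c =>
    reachable_of_forall_adj (fun a c hac => by
      by_cases hcore : a ∈ P.core ∨ c ∈ P.core
      · obtain ⟨⟨haB, haC⟩, hcB, hcC⟩ : (a ∉ P.B ∧ a ∉ P.C) ∧ c ∉ P.B ∧ c ∉ P.C := by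
          rcases hcore with ha | hc
          · exact ⟨⟨ha.1, ha.2.1⟩, P.notMem_of_adj_core ha hac.symm⟩
          · exact ⟨P.notMem_of_adj_core hc hac, hc.1, hc.2.1⟩
        exact (P.slide_adj_shift haB haC hcB hcC hac).reachable
      · obtain ⟨ha, hc⟩ := not_or.1 hcore
        rcases P.shift_eq_or_eq ha with h | h <;> rcases P.shift_eq_or_eq hc with h' | h' <;>
          rw [h, h']
        exacts [huu'.symm, huu']) (hG a c)
  have hu : ∀ a, P.slide.Reachable P.u a := by
    intro a
    by_cases ha : a ∈ P.core
    · have hua := hshift P.v a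
      rwa [P.shift_v, P.shift_of_mem_core ha] at hua
    · exact htrunk a ha
  have := hG.nonempty
  exact ⟨fun a c => (hu a).symm.trans (hu c)⟩

theorem colorable_slide (hG : G.Colorable k) : P.slide.Colorable k := by
  classical
  obtain ⟨γ⟩ := hG
  have huv := γ.valid P.adj
  -- A coloring of the trunk giving `u'` and `u` the colours of `u` and `v`.
  obtain ⟨δ, hδu', hδ⟩ := P.left.exists_coloring (γ := Equiv.swap (γ P.u) (γ P.v) ∘ γ)
    (e := γ P.u) (fun a c _ hac => (Equiv.swap _ _).injective.ne (γ.valid hac))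
    (by rwa [Function.comp_apply, Equiv.swap_apply_left])
  have hδu : δ P.u = γ P.v := by
    rw [hδ _ P.left.notMem, Function.comp_apply, Equiv.swap_apply_left]
  have hfold : ∀ a ∈ insert P.u (insert P.u' P.core),
      (if a ∈ P.core then γ a else δ a) = γ (P.fold a) := by
    rintro a (rfl | rfl | ha)
    · rw [if_neg P.u_notMem_core, P.fold_u, hδu]
    · rw [if_neg (P.notMem_core_of_mem_B P.left.mem), P.fold_of_mem_B P.left.mem, hδu']
    · rw [if_pos ha, P.fold_of_mem_core ha]
  refine ⟨Coloring.mk (fun a => if a ∈ P.core then γ a else δ a) fun {a c} hac => ?_⟩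
  rcases hac with ⟨ha, hc, hac⟩ | ⟨ha, hc, hac⟩
  · rw [if_neg ha, if_neg hc]
    exact δ.valid hac
  · rw [hfold a ha, hfold c hc]
    exact γ.valid hac

theorem dist_fold_le (hG : G.Connected) (i j : V) :
    G.dist (P.fold i) (P.fold j) ≤ P.slide.dist i j := by
  refine dist_map_le (fun a c hac => ?_) (P.connected_slide hG i j)
  rcases hac with ⟨ha, hc, -⟩ | ⟨-, -, hac⟩
  · rcases P.fold_eq_or_eq ha with h | h <;> rcases P.fold_eq_or_eq hc with h' | h' <;> rw [h, h']
    exacts [.inl rfl, .inr P.adj, .inr P.adj.symm, .inl rfl]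
  · exact .inr hac

theorem dist_le_dist_slide_of_notMem_core (hG : G.Connected) (hi : i ∉ P.core)
    (hj : j ∉ P.core) : G.dist i j ≤ P.slide.dist i j := by
  classical
  have h := dist_map_le (G' := G) (f := fun a => if a ∈ P.core then P.u else a)
    (fun a c hac => ?_) (P.connected_slide hG i j)
  · simpa only [if_neg hi, if_neg hj] using h
  · rcases hac with ⟨ha, hc, hac⟩ | ⟨ha, hc, -⟩
    · simp only [if_neg ha, if_neg hc]
      exact .inr hac
    · have hu' := P.notMem_core_of_mem_B P.left.mem
      rcases ha with rfl | rfl | ha <;> rcases hc with rfl | rfl | hc <;>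
        simp [*, P.u_notMem_core, P.left.adj, P.left.adj.symm]

theorem dist_le_dist_slide_of_mem_core (hG : G.Connected) (hz : z ∈ P.core) (ha : a ∈ P.core) :
    G.dist z a ≤ P.slide.dist z a := by
  simpa only [P.fold_of_mem_core hz, P.fold_of_mem_core ha] using P.dist_fold_le hG z a

theorem dist_v_le_dist_slide_u (hG : G.Connected) (hz : z ∈ P.core) :
    G.dist z P.v ≤ P.slide.dist z P.u := by
  simpa only [P.fold_of_mem_core hz, P.fold_u] using P.dist_fold_le hG z P.u

theorem dist_le_dist_slide_add_one (hG : G.Connected) (hz : z ∈ P.core) (ha : a ∈ P.B) :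
    G.dist z a ≤ P.slide.dist z a + 1 := by
  have hu' := P.dist_fold_le hG z P.u'
  rw [P.fold_of_mem_core hz, P.fold_of_mem_B P.left.mem] at hu'
  have htrunk := P.dist_le_dist_slide_of_notMem_core hG (P.notMem_core_of_mem_B ha)
    (P.notMem_core_of_mem_B P.left.mem)
  have hslide := P.isAttachedAt_slide.dist_eq (P.connected_slide hG) ha hz.1
  have hdist := P.left.dist_eq hG ha hz.1
  rw [dist_comm, dist_comm (G := P.slide), hdist, hslide, dist_comm (v := z), dist_comm (v := z)]
  omega

theorem dist_add_one_le_dist_slide (hG : G.Connected) (hz : z ∈ P.core)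
    (ha : a ∈ insert P.v P.C) : G.dist z a + 1 ≤ P.slide.dist z a := by
  have hu := P.dist_v_le_dist_slide_u hG hz
  have htrunk := P.dist_le_dist_slide_of_notMem_core hG (P.notMem_core_of_mem_insert ha)
    P.v_notMem_core
  have hslide := P.isBridgeSide_slide.dist_eq (P.connected_slide hG) ha
    fun h => P.notMem_core_of_mem_insert h hz
  have htri : G.dist a z ≤ G.dist a P.v + G.dist P.v z := hG.dist_triangle
  rw [dist_comm, dist_comm (G := P.slide), hslide]
  rw [dist_comm, dist_comm (G := P.slide)] at hu
  omega

theorem mem_cases (a : V) :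
    a ∈ P.core ∨ a ∈ P.B ∨ a ∈ P.C ∨ a = P.u ∨ a = P.v := by
  by_contra! h
  exact h.1 h.2

theorem two_mul_dist_le_of_mem_core (hG : G.Connected) (hz : z ∈ P.core) (a : V) :
    2 * G.dist z a ≤ P.slide.dist z a + P.symm.slide.dist z a := by
  have hz' : z ∈ P.symm.core := P.core_symm ▸ hz
  rcases P.mem_cases a with ha | ha | ha | rfl | rfl
  · have hB := P.dist_le_dist_slide_of_mem_core hG hz ha
    have hC := P.symm.dist_le_dist_slide_of_mem_core hG hz' (P.core_symm ▸ ha)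
    omega
  · have hB := P.dist_le_dist_slide_add_one hG hz ha
    have hC := P.symm.dist_add_one_le_dist_slide hG hz' (.inr ha)
    omega
  · have hB := P.dist_add_one_le_dist_slide hG hz (.inr ha)
    have hC := P.symm.dist_le_dist_slide_add_one hG hz' ha
    omega
  · have hB := P.dist_v_le_dist_slide_u hG hz
    have hC : G.dist z P.u + 1 ≤ P.symm.slide.dist z P.u :=
      P.symm.dist_add_one_le_dist_slide hG hz' (.inl rfl)
    have huv := P.adj.symm.diff_dist_adj (u := z)
    omega
  · have hB := P.dist_add_one_le_dist_slide hG hz (.inl rfl)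
    have hC : G.dist z P.u ≤ P.symm.slide.dist z P.v := P.symm.dist_v_le_dist_slide_u hG hz'
    have huv := P.adj.diff_dist_adj (u := z)
    omega

theorem two_mul_dist_le (hG : G.Connected) (i j : V) :
    2 * G.dist i j ≤ P.slide.dist i j + P.symm.slide.dist i j := by
  by_cases hi : i ∈ P.core
  · exact P.two_mul_dist_le_of_mem_core hG hi j
  by_cases hj : j ∈ P.core
  · rw [dist_comm, P.slide.dist_comm, P.symm.slide.dist_comm]
    exact P.two_mul_dist_le_of_mem_core hG hj i
  have hB := P.dist_le_dist_slide_of_notMem_core hG hi hj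
  have hC := P.symm.dist_le_dist_slide_of_notMem_core hG (P.core_symm ▸ hi) (P.core_symm ▸ hj)
  omega

theorem two_mul_dist_add_dist_lt (hG : G.Connected) (hz : z ∈ P.core) :
    2 * G.dist z P.u + 2 * G.dist z P.v <
      (P.slide.dist z P.u + P.symm.slide.dist z P.u) +
        (P.slide.dist z P.v + P.symm.slide.dist z P.v) := by
  have hz' : z ∈ P.symm.core := P.core_symm ▸ hz
  have hBu := P.dist_v_le_dist_slide_u hG hz
  have hBv := P.dist_add_one_le_dist_slide hG hz (.inl rfl)
  have hCu : G.dist z P.u + 1 ≤ P.symm.slide.dist z P.u :=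
    P.symm.dist_add_one_le_dist_slide hG hz' (.inl rfl)
  have hCv : G.dist z P.u ≤ P.symm.slide.dist z P.v := P.symm.dist_v_le_dist_slide_u hG hz'
  omega

end BranchPair

end Slide

section Extremal

variable {V : Type*} {G : SimpleGraph V} {H : G.Subgraph} {k n : ℕ} {a b c d u v w : V}

/-- The vertex `v` lies on an edge of `G` outside the subgraph `H`. -/
def HasBranchAt (H : G.Subgraph) (v : V) : Prop := ∃ a, G.Adj v a ∧ ¬H.Adj v a

theorem deleteEdges_adj_of_adj (hab : ¬H.Adj a b) (hcd : H.Adj c d) :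
    (G.deleteEdges {s(a, b)}).Adj c d := by
  refine deleteEdges_adj.2 ⟨H.adj_sub hcd, fun h => hab ?_⟩
  rwa [← H.mem_edgeSet, ← Set.mem_singleton_iff.1 h]

theorem exists_branchPair (hG : G.Connected) (hH : H.Connected)
    (hbr : ∀ ⦃a b⦄, G.Adj a b → ¬H.Adj a b → G.IsBridge s(a, b)) (huv : H.Adj u v)
    (hu : HasBranchAt H u) (hv : HasBranchAt H v) :
    ∃ P : BranchPair G, P.u = u ∧ P.v = v ∧ ∀ z ∈ H.verts, z ∉ P.B ∧ z ∉ P.C := by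
  obtain ⟨u', hu', huH⟩ := hu
  obtain ⟨v', hv', hvH⟩ := hv
  obtain ⟨B, hB⟩ := exists_isBridgeSide hu' (hbr hu' huH)
  obtain ⟨C, hC⟩ := exists_isBridgeSide hv' (hbr hv' hvH)
  have hHB : ∀ z ∈ H.verts, z ∉ B := fun z => hB.notMem_of_mem_verts hH huv.fst_mem huH
  have hHC : ∀ z ∈ H.verts, z ∉ C := fun z => hC.notMem_of_mem_verts hH huv.snd_mem hvH
  have hvB := hHB v huv.snd_mem
  have huC := hHC u huv.fst_mem
  exact ⟨⟨u, v, u', v', B, C, hB, hC, huv.adj_sub, hvB, huC,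
    hB.disjoint hC hG hvB huC huv.adj_sub.ne⟩, rfl, rfl, fun z hz => ⟨hHB z hz, hHC z hz⟩⟩

theorem exists_mem_verts_ne_ne (hH : ¬H.coe.Colorable 2) (u v : V) :
    ∃ z ∈ H.verts, z ≠ u ∧ z ≠ v := by
  classical
  by_contra! hno
  refine hH ⟨Coloring.mk (fun a => if a.1 = u then 0 else 1) fun {a c} hac => ?_⟩
  have hne : a.1 ≠ c.1 := (H.adj_sub hac).ne
  have ha := hno a.1 a.2
  have hc := hno c.1 c.2
  grind

variable [Fintype V]

/-- `H` is a `k`-chromatic subgraph of the connected `k`-colorable graph `G`, whose distance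
spectral radius cannot be increased by passing to another connected `k`-colorable graph on the same
vertices as long as `H` still maps to it. The homomorphism keeps the chromatic number equal to `k`,
so this holds for the maximizers of the theorem. -/
structure IsExtremalOver (k : ℕ) (H : G.Subgraph) : Prop where
  connected : G.Connected
  colorable : G.Colorable k
  chromaticNumber_eq : H.coe.chromaticNumber = k
  le_of_hom : ∀ {G' : SimpleGraph V}, G'.Connected → G'.Colorable k → (H.coe →g G') →
    G'.distanceSpectralRadius ≤ G.distanceSpectralRadius

theorem isExtremalOver_of_maximizes (hG : G.MaximizesDistanceSpectralRadius k n)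
    (hH : H.coe.chromaticNumber = k) : IsExtremalOver k H where
  connected := hG.1.connected
  colorable := chromaticNumber_le_iff_colorable.1 hG.1.chromaticNumber_eq.le
  chromaticNumber_eq := hH
  le_of_hom := fun {G'} hconn hcol f => hG.2 V G' ⟨hG.1.card_eq, hconn,
    le_antisymm hcol.chromaticNumber_le (hH ▸ chromaticNumber_mono_of_hom f)⟩

namespace IsExtremalOver

theorem le_of_adj (h : IsExtremalOver k H) {G' : SimpleGraph V} (hG' : G'.Connected)
    (hk : G'.Colorable k) (hadj : ∀ ⦃c d⦄, H.Adj c d → G'.Adj c d) :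
    G'.distanceSpectralRadius ≤ G.distanceSpectralRadius :=
  h.le_of_hom hG' hk ⟨Subtype.val, fun {_ _} hcd => hadj hcd⟩

theorem two_le_of_adj (h : IsExtremalOver k H) (hab : G.Adj a b) : 2 ≤ k :=
  Nat.cast_le.1 ((two_le_chromaticNumber_of_adj hab).trans h.colorable.chromaticNumber_le)

theorem exists_adj (h : IsExtremalOver k H) (hH : H.Connected) (hab : G.Adj a b)
    (hv : v ∈ H.verts) : ∃ c, H.Adj v c := by
  have h2 : 2 ≤ H.coe.chromaticNumber :=
    h.chromaticNumber_eq ▸ Nat.cast_le.2 (h.two_le_of_adj hab)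
  obtain ⟨x, y, hxy⟩ := ne_bot_iff_exists_adj.1 (two_le_chromaticNumber_iff_ne_bot.1 h2)
  have : Nontrivial H.verts := ⟨x, y, hxy.ne⟩
  obtain ⟨c, hc⟩ := hH.coe.preconnected.exists_adj_of_nontrivial ⟨v, hv⟩
  exact ⟨c, hc⟩

theorem isBridge (h : IsExtremalOver k H) (hab : G.Adj a b) (hH : ¬H.Adj a b) :
    G.IsBridge s(a, b) := by
  by_contra hbr
  have hconn := h.connected.connected_delete_edge_of_not_isBridge hbr
  have hle := h.le_of_adj hconn (h.colorable.mono_left (deleteEdges_le _))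
    fun _ _ => deleteEdges_adj_of_adj hH
  have heq := two_mul_dist_eq h.connected hle hle (fun i j => by
    have := (hconn i j).dist_anti (deleteEdges_le {s(a, b)})
    omega) a b
  have hlt := hconn.one_lt_dist_of_ne_of_not_adj hab.ne (by simp)
  rw [dist_eq_one_iff_adj.2 hab] at heq
  omega

theorem moveBranch_le {B : Set V} {w' : V} (h : IsExtremalOver k H) (hB : IsBridgeSide G B w b)
    (hw' : w' ∉ B) (hH : ¬H.Adj w b) :
    (moveBranch G w b w').distanceSpectralRadius ≤ G.distanceSpectralRadius :=
  h.le_of_adj (hB.connected_moveBranch h.connected hw') (hB.colorable_moveBranch hw' h.colorable)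
    fun _ _ hcd => .inl (deleteEdges_adj_of_adj hH hcd)

theorem eq_of_adj_of_branches (h : IsExtremalOver k H) (hb : G.Adj w b) (hbH : ¬H.Adj w b)
    (hc : G.Adj w c) (hcH : ¬H.Adj w c) (hd : G.Adj w d) (hcb : c ≠ b) (hdb : d ≠ b) :
    d = c := by
  by_contra hdc
  obtain ⟨B, hB⟩ := exists_isBridgeSide hb (h.isBridge hb hbH)
  obtain ⟨C, hC⟩ := exists_isBridgeSide hc (h.isBridge hc hcH)
  have hcB : c ∉ B := fun hcB => hcb (hB.eq_of_adj hcB hB.notMem hc.symm).1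
  have hdB : d ∉ B := fun hdB => hdb (hB.eq_of_adj hdB hB.notMem hd.symm).1
  have heq := two_mul_dist_eq h.connected (h.moveBranch_le hB hcB hbH)
    (h.moveBranch_le hB hdB hbH) (hB.two_mul_dist_le_moveBranch hC h.connected hd hcb hdb hdc) b w
  have hltc := hB.dist_lt_dist_moveBranch h.connected hcB hc.ne'
  have hltd := hB.dist_lt_dist_moveBranch h.connected hdB hd.ne'
  omega

theorem slide_le (h : IsExtremalOver k H) (P : BranchPair G)
    (hP : ∀ z ∈ H.verts, z ∉ P.B ∧ z ∉ P.C) :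
    P.slide.distanceSpectralRadius ≤ G.distanceSpectralRadius :=
  h.le_of_hom (P.connected_slide h.connected) (P.colorable_slide h.colorable)
    ⟨fun x => P.shift x, fun {x y} hxy => P.slide_adj_shift (hP x x.2).1 (hP x x.2).2
      (hP y y.2).1 (hP y y.2).2 (H.adj_sub hxy)⟩

theorem not_hasBranchAt_of_adj (h : IsExtremalOver k H) (hH : H.Connected) (hk : 2 < k)
    (huv : H.Adj u v) (hu : HasBranchAt H u) : ¬HasBranchAt H v := by
  intro hv
  obtain ⟨P, rfl, rfl, hP⟩ := exists_branchPair h.connected hH (fun _ _ => h.isBridge) huv hu hv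
  have hcol : ¬H.coe.Colorable 2 := fun hcol => hk.not_ge <| Nat.cast_le.1 <|
    h.chromaticNumber_eq.symm.trans_le hcol.chromaticNumber_le
  obtain ⟨z, hz, hzu, hzv⟩ := exists_mem_verts_ne_ne hcol P.u P.v
  have heq := two_mul_dist_eq h.connected (h.slide_le P hP)
    (h.slide_le P.symm fun z hz => (hP z hz).symm) (P.two_mul_dist_le h.connected)
  have hlt := P.two_mul_dist_add_dist_lt h.connected ⟨(hP z hz).1, (hP z hz).2, hzu, hzv⟩
  have hequ := heq z P.u
  have heqv := heq z P.v
  omega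

end IsExtremalOver

end Extremal

section Critical

variable {V : Type*} {G : SimpleGraph V} {k : ℕ}

theorem eq_top_of_le_coeSubgraph {H : G.Subgraph} {K : H.coe.Subgraph}
    (h : H ≤ Subgraph.coeSubgraph K) : K = ⊤ := by
  refine top_le_iff.1 ⟨fun a _ => ?_, fun a b hab => ?_⟩
  · obtain ⟨x, hx, hxa⟩ := h.1 a.2
    rwa [← Subtype.ext hxa]
  · obtain ⟨x, y, hxy, hxa, hyb⟩ := h.2 hab
    rwa [← Subtype.ext (a1 := x) (a2 := a) hxa, ← Subtype.ext (a1 := y) (a2 := b) hyb]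

theorem exists_isCritical_le [Finite V] (H₀ : G.Subgraph) (h₀ : H₀.coe.chromaticNumber = k) :
    ∃ H ≤ H₀, H.coe.IsCritical k := by
  obtain ⟨H, ⟨hle, hk⟩, hmin⟩ := Set.Finite.exists_minimal
    (Set.toFinite {H : G.Subgraph | H ≤ H₀ ∧ (k : ℕ∞) ≤ H.coe.chromaticNumber})
    ⟨H₀, le_rfl, h₀.ge⟩
  refine ⟨H, hle, le_antisymm ?_ hk, fun K hK => ?_⟩
  · exact h₀ ▸ chromaticNumber_mono_of_hom (Subgraph.inclusion hle)
  · by_contra! hge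
    have hKH := Subgraph.coeSubgraph_le K
    have hKmap : K.coe →g (Subgraph.coeSubgraph K).coe :=
      ⟨fun a => ⟨a.1.1, a.1, a.2, rfl⟩, fun {a b} hab => ⟨a.1, b.1, hab, rfl, rfl⟩⟩
    exact hK (eq_top_of_le_coeSubgraph
      (hmin ⟨hKH.trans hle, hge.trans (chromaticNumber_mono_of_hom hKmap)⟩ hKH))

theorem ne_zero_of_chromaticNumber_eq [Nonempty V] (hG : G.chromaticNumber = k) : k ≠ 0 := by
  rintro rfl
  exact not_isEmpty_of_nonempty V (chromaticNumber_eq_zero_iff.1 hG)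

theorem connected_of_isCritical (hk : k ≠ 0) (hG : G.IsCritical k) : G.Connected := by
  have hne : Nonempty V := by
    by_contra h
    rw [not_nonempty_iff, ← chromaticNumber_eq_zero_iff, hG.1] at h
    exact hk (by exact_mod_cast h)
  refine ⟨?_⟩
  by_contra hpre
  have hcol : G.Colorable (k - 1) := by
    rw [colorable_iff_forall_connectedComponent]
    intro C
    have hC : C.toSubgraph ≠ ⊤ := fun h => hpre fun a b =>
      ((h ▸ C.connected_toSubgraph).preconnected.coe ⟨a, trivial⟩ ⟨b, trivial⟩).map
        (Subgraph.hom _)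
    have hlt := hG.2 _ hC
    have hle : C.toSubgraph.coe.chromaticNumber ≤ (k - 1 : ℕ) := by
      obtain ⟨m, rfl⟩ := Nat.exists_eq_succ_of_ne_zero hk
      simpa [ENat.lt_add_one_iff] using hlt
    rwa [chromaticNumber_le_iff_colorable, C.coe_toSubgraph] at hle
  have hle : k ≤ k - 1 := Nat.cast_le.1 (hG.1.symm.trans_le hcol.chromaticNumber_le)
  omega

end Critical

section PathAttachment

variable {V : Type*} {G : SimpleGraph V} {H : G.Subgraph} {a b c e e' u v w x : V}

theorem notMem_verts_of_isBridge {K : G.Subgraph} (hab : G.Adj a b) (hbr : G.IsBridge s(a, b))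
    (hK : K.Connected) (ha : a ∈ K.verts) (hKab : ¬K.Adj a b) : b ∉ K.verts := fun hb =>
  have ⟨_, hB⟩ := exists_isBridgeSide hab hbr
  hB.notMem_of_mem_verts hK ha hKab hb hB.mem

theorem exists_ne_adj_adj_of_isPath {p : G.Walk u v} (hp : p.IsPath) (ha : a ∈ p.support)
    (hau : a ≠ u) (hav : a ≠ v) :
    ∃ b ∈ p.support, ∃ c ∈ p.support, b ≠ c ∧ G.Adj a b ∧ G.Adj a c := by
  obtain ⟨i, rfl, hi⟩ := Walk.mem_support_iff_exists_getVert.1 ha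
  have hi₀ : i ≠ 0 := by
    rintro rfl
    exact hau p.getVert_zero
  have hil : i ≠ p.length := by
    rintro rfl
    exact hav p.getVert_length
  obtain ⟨b, c, hbc, hnb⟩ := Set.ncard_eq_two.1
    (hp.ncard_neighborSet_toSubgraph_internal_eq_two hi₀ (hi.lt_of_ne hil))
  have hb : p.toSubgraph.Adj (p.getVert i) b := hnb.symm.subset (.inl rfl)
  have hc : p.toSubgraph.Adj (p.getVert i) c := hnb.symm.subset (.inr rfl)
  exact ⟨b, p.mem_verts_toSubgraph.1 hb.snd_mem, c, p.mem_verts_toSubgraph.1 hc.snd_mem, hbc,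
    hb.adj_sub, hc.adj_sub⟩

/-- A path from a vertex `v` of `H` that meets `H` only in `v` and is maximal among such paths:
every neighbor of its end lies in `H` or on the path. -/
structure IsHangingPath (H : G.Subgraph) (p : G.Walk v e) : Prop where
  mem_verts : v ∈ H.verts
  isPath : p.IsPath
  eq_of_mem : ∀ ⦃x⦄, x ∈ p.support → x ∈ H.verts → x = v
  mem_of_adj : ∀ ⦃b⦄, G.Adj e b → b ∈ H.verts ∨ b ∈ p.support

theorem exists_isHangingPath [Finite V] (hv : v ∈ H.verts) :
    ∃ (e : V) (p : G.Walk v e), IsHangingPath H p := by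
  have := Fintype.ofFinite V
  obtain ⟨⟨e, p⟩, ⟨hp, hpH⟩, hmax⟩ := Set.Finite.exists_maximalFor'
    (fun q : Σ e, G.Walk v e => q.2.length)
    {q | q.2.IsPath ∧ ∀ ⦃x⦄, x ∈ q.2.support → x ∈ H.verts → x = v}
    ((Set.finite_lt_nat (Fintype.card V)).subset (by
      rintro _ ⟨q, hq, rfl⟩
      exact hq.1.length_lt))
    ⟨⟨v, .nil⟩, .nil, by simp⟩
  refine ⟨e, p, hv, hp, hpH, fun b hb => ?_⟩
  by_contra! hb'
  have hle := hmax (j := ⟨b, p.concat hb⟩) ⟨hp.concat hb'.2 hb, fun x hx hxH => ?_⟩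
  · simp at hle
  · rw [Walk.support_concat, List.mem_append, List.mem_singleton] at hx
    rcases hx with hx | rfl
    exacts [hpH hx hxH, absurd hxH hb'.1]

theorem IsHangingPath.connected_sup {p : G.Walk v e} (hp : IsHangingPath H p)
    (hH : H.Connected) : (H ⊔ p.toSubgraph).Connected :=
  Subgraph.connected_sup hH.preconnected p.toSubgraph_connected.preconnected
    ⟨v, hp.mem_verts, p.start_mem_verts_toSubgraph⟩

theorem IsHangingPath.not_adj_snd {p : G.Walk v e} (hp : IsHangingPath H p) (hnil : ¬p.Nil) :
    ¬H.Adj v p.snd := fun h =>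
  (p.adj_snd hnil).ne' (hp.eq_of_mem (p.getVert_mem_support 1) h.snd_mem)

/-- The local structure that makes `G` the union of its connected subgraph `H` and of disjoint
paths attached to it: the edges outside `H` are bridges, each vertex of `H` is on at most one of
them, and the other vertices have degree at most two. -/
structure HasPathBranches (H : G.Subgraph) : Prop where
  connected : G.Connected
  connected_verts : H.Connected
  isBridge : ∀ ⦃a b⦄, G.Adj a b → ¬H.Adj a b → G.IsBridge s(a, b)
  eq_of_mem : ∀ ⦃v⦄, v ∈ H.verts → ∀ ⦃a b⦄, G.Adj v a → ¬H.Adj v a → G.Adj v b → ¬H.Adj v b →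
    b = a
  eq_of_notMem : ∀ ⦃v⦄, v ∉ H.verts → ∀ ⦃a b c⦄, G.Adj v a → G.Adj v b → G.Adj v c → b ≠ a →
    c ≠ a → c = b

namespace HasPathBranches

theorem adj_sup_of_mem_support (h : HasPathBranches H) {p : G.Walk v e} (hp : IsHangingPath H p)
    (ha : a ∈ p.support) (hab : G.Adj a b) : (H ⊔ p.toSubgraph).Adj a b := by
  by_contra hK
  have hHab : ¬H.Adj a b := fun hHab => hK (.inl hHab)
  have hb := notMem_verts_of_isBridge hab (h.isBridge hab hHab)
    (hp.connected_sup h.connected_verts) (.inr (p.mem_verts_toSubgraph.2 ha)) hK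
  rw [Subgraph.verts_sup, Set.mem_union, p.mem_verts_toSubgraph, not_or] at hb
  obtain ⟨hbH, hbp⟩ := hb
  have hae : a ≠ e := by
    rintro rfl
    exact (hp.mem_of_adj hab).elim hbH hbp
  by_cases hav : a = v
  · subst hav
    have hnil : ¬p.Nil := Walk.not_nil_of_ne hae
    have hsnd := h.eq_of_mem hp.mem_verts (p.adj_snd hnil) (hp.not_adj_snd hnil) hab hHab
    exact hbp (hsnd ▸ p.getVert_mem_support 1)
  · obtain ⟨c, hc, d, hd, hcd, hac, had⟩ := exists_ne_adj_adj_of_isPath hp.isPath ha hav hae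
    exact hcd (h.eq_of_notMem (fun haH => hav (hp.eq_of_mem ha haH)) hab had hac
      (fun hdb => hbp (hdb ▸ hd)) fun hcb => hbp (hcb ▸ hc))

theorem disjoint_support (h : HasPathBranches H) {p : G.Walk v e} {q : G.Walk w e'}
    (hp : IsHangingPath H p) (hq : IsHangingPath H q) (hvw : v ≠ w) :
    List.Disjoint p.support q.support := by
  intro x hxp hxq
  have hvq : v ∉ q.support := fun hvq => hvw (hq.eq_of_mem hvq hp.mem_verts)
  have hxv : x ≠ v := fun hxv => hvq (hxv ▸ hxq)
  cases p with
  | nil => exact hxv (List.mem_singleton.1 hxp)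
  | @cons _ b _ hadj r =>
    -- The first edge of `p` separates the rest of `p` from `H` and `q`.
    have hnot : ¬H.Adj v b := by simpa using hp.not_adj_snd Walk.not_nil_cons
    obtain ⟨B, hB⟩ := exists_isBridgeSide hadj (h.isBridge hadj hnot)
    have hnotK : ¬(H ⊔ q.toSubgraph).Adj v b := fun hK =>
      hK.elim hnot fun hK => hvq (q.mem_verts_toSubgraph.1 hK.fst_mem)
    have hxB : x ∉ B := hB.notMem_of_mem_verts (hq.connected_sup h.connected_verts)
      (.inl hp.mem_verts) hnotK (.inr (q.mem_verts_toSubgraph.2 hxq))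
    have hvr := ((Walk.cons_isPath_iff _ _).1 hp.isPath).2
    refine hB.symm.notMem_of_mem_verts r.toSubgraph_connected r.start_mem_verts_toSubgraph
      (fun hK => hvr (r.mem_verts_toSubgraph.1 hK.snd_mem)) ?_ hxB
    exact r.mem_verts_toSubgraph.2 ((List.mem_cons.1 hxp).resolve_left hxv)

theorem sup_iSup_toSubgraph_eq_top (h : HasPathBranches H) {e : H.verts → V}
    {p : ∀ v : H.verts, G.Walk (v : V) (e v)} (hp : ∀ v, IsHangingPath H (p v)) :
    H ⊔ ⨆ v, (p v).toSubgraph = ⊤ := by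
  have hadj : ∀ a ∈ (H ⊔ ⨆ v, (p v).toSubgraph).verts, ∀ b, G.Adj a b →
      (H ⊔ ⨆ v, (p v).toSubgraph).Adj a b := by
    intro a ha b hab
    obtain ⟨v, hv⟩ : ∃ v, a ∈ (p v).support := by
      rw [Subgraph.verts_sup, Subgraph.verts_iSup] at ha
      rcases ha with ha | ha
      · exact ⟨⟨a, ha⟩, Walk.start_mem_support _⟩
      · obtain ⟨v, hv⟩ := Set.mem_iUnion.1 ha
        exact ⟨v, (p v).mem_verts_toSubgraph.1 hv⟩
    exact (sup_le_sup_left (le_iSup (fun v => (p v).toSubgraph) v) H).2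
      (h.adj_sup_of_mem_support (hp v) hv hab)
  obtain ⟨v, hv⟩ := h.connected_verts.nonempty
  have hverts : ∀ a, a ∈ (H ⊔ ⨆ v, (p v).toSubgraph).verts := by
    intro a
    by_contra ha
    obtain ⟨q⟩ := h.connected v a
    obtain ⟨d, -, hd, hd'⟩ := q.exists_boundary_dart _ (.inl hv) ha
    exact hd' (hadj _ hd _ d.adj).snd_mem
  exact top_le_iff.1 ⟨fun a _ => hverts a, fun a b hab => hadj a (hverts a) b hab⟩

theorem nonempty_pathAttachment [Finite V] (h : HasPathBranches H) :
    Nonempty (PathAttachment H) := by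
  choose e p hp using fun v : H.verts => exists_isHangingPath v.2
  exact ⟨e, p, fun v => (hp v).isPath, fun v => (hp v).eq_of_mem, fun v w hvw =>
    h.disjoint_support (hp v) (hp w) (Subtype.coe_ne_coe.2 hvw), h.sup_iSup_toSubgraph_eq_top hp⟩

end HasPathBranches

theorem hasBranchAt_of_mem_nontrivialVerts (A : PathAttachment H) {v : H.verts}
    (hv : v ∈ A.nontrivialVerts) : HasBranchAt H v := by
  have hadj := (A.path v).adj_snd (Walk.not_nil_iff_lt_length.2 hv)
  exact ⟨_, hadj, fun h =>
    hadj.ne' (A.eq_of_mem v _ (Walk.getVert_mem_support _ _) h.snd_mem)⟩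

end PathAttachment

section Leaf

theorem eq_of_adj_of_preconnected_induce_compl {V : Type*} {G : SimpleGraph V} {l m a : V}
    (hl : (G.induce {l}ᶜ).Preconnected) (hm : G.Adj l m) (ha : G.Adj l a)
    (hbr : a ≠ m → G.IsBridge s(l, a)) : a = m := by
  by_contra ham
  have hK : ((⊤ : G.Subgraph).induce {l}ᶜ ⊔ G.subgraphOfAdj hm).Connected :=
    Subgraph.connected_sup (preconnected_induce_iff.1 hl)
      (Subgraph.subgraphOfAdj_connected hm).preconnected ⟨m, by simpa using hm.ne'⟩
  refine notMem_verts_of_isBridge ha (hbr ham) hK (by simp) ?_ (.inl ha.ne')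
  have hla := ha.ne
  simp only [Subgraph.sup_adj, Subgraph.induce_adj, Set.mem_compl_iff, Set.mem_singleton_iff,
    not_true_eq_false, false_and, subgraphOfAdj_adj, false_or]
  grind

end Leaf

section Maximal

variable {V : Type*} [Fintype V] {G : SimpleGraph V} {H : G.Subgraph} {k n : ℕ}

theorem IsExtremalOver.hasPathBranches (h : IsExtremalOver k H) (hH : H.Connected) :
    HasPathBranches H where
  connected := h.connected
  connected_verts := hH
  isBridge _ _ := h.isBridge
  eq_of_mem := by
    intro v hv a b ha haH hb hbH
    by_contra hba
    obtain ⟨c, hc⟩ := h.exists_adj hH ha hv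
    have hcb : c = b := h.eq_of_adj_of_branches ha haH hb hbH hc.adj_sub hba
      fun hca => haH (hca ▸ hc)
    exact hbH (hcb ▸ hc)
  eq_of_notMem := fun v hv a b c ha hb hc =>
    h.eq_of_adj_of_branches ha (fun haH => hv haH.fst_mem) hb (fun hbH => hv hbH.fst_mem) hc

theorem exists_isCritical_of_maximizes_two (hG : G.MaximizesDistanceSpectralRadius 2 n) :
    ∃ H : G.Subgraph, H.coe.IsCritical 2 ∧
      ∀ ⦃u v⦄, H.Adj u v → HasBranchAt H u → ¬HasBranchAt H v := by
  have h2 : 2 ≤ G.chromaticNumber := hG.1.chromaticNumber_eq.ge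
  obtain ⟨x, y, hxy⟩ := ne_bot_iff_exists_adj.1 (two_le_chromaticNumber_iff_ne_bot.1 h2)
  have : Nontrivial V := ⟨x, y, hxy.ne⟩
  obtain ⟨l, hl⟩ := hG.1.connected.exists_preconnected_induce_compl_singleton_of_finite
  obtain ⟨m, hm⟩ := hG.1.connected.preconnected.exists_adj_of_nontrivial l
  have hedge : (G.subgraphOfAdj hm).coe.chromaticNumber = (2 : ℕ) := by
    refine le_antisymm (hG.1.chromaticNumber_eq ▸ chromaticNumber_mono_of_hom (Subgraph.hom _)) ?_
    exact two_le_chromaticNumber_of_adj (u := ⟨l, by simp⟩) (v := ⟨m, by simp⟩) (by simp)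
  obtain ⟨H, hle, hH⟩ := exists_isCritical_le _ hedge
  -- The end `l` of the edge `lm` containing `H` is a leaf of `G`.
  have hleaf : ∀ a, G.Adj l a → a = m := fun a ha =>
    eq_of_adj_of_preconnected_induce_compl hl hm ha fun ham =>
      (isExtremalOver_of_maximizes hG hedge).isBridge ha (by simpa [ha.ne] using ham.symm)
  have hbranch : H.Adj l m → ¬HasBranchAt H l := fun hlm ⟨a, ha, haH⟩ => haH (hleaf a ha ▸ hlm)
  refine ⟨H, hH, fun u v huv hu hv => ?_⟩
  obtain ⟨rfl, rfl⟩ | ⟨rfl, rfl⟩ := Sym2.eq_iff.1 (hle.2 huv)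
  exacts [hbranch huv hu, hbranch huv.symm hv]

theorem exists_isCritical_of_maximizes (hk : k ≠ 0)
    (hG : G.MaximizesDistanceSpectralRadius k n) :
    ∃ H : G.Subgraph, H.coe.IsCritical k ∧
      ∀ ⦃u v⦄, H.Adj u v → HasBranchAt H u → ¬HasBranchAt H v := by
  obtain rfl | hk2 := eq_or_ne k 2
  · exact exists_isCritical_of_maximizes_two hG
  have htop : (⊤ : G.Subgraph).coe.chromaticNumber = k :=
    (chromaticNumber_congr Subgraph.topIso).trans hG.1.chromaticNumber_eq
  obtain ⟨H, -, hH⟩ := exists_isCritical_le _ htop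
  have h := isExtremalOver_of_maximizes hG hH.1
  exact ⟨H, hH, fun u v huv => h.not_hasBranchAt_of_adj ⟨connected_of_isCritical hk hH⟩
    ((h.two_le_of_adj huv.adj_sub).lt_of_ne' hk2) huv⟩

end Maximal

end DistanceSpectral

theorem mainTheorem4 {V : Type u} [Fintype V] (k n : ℕ) (G : SimpleGraph V)
    (hG : G.MaximizesDistanceSpectralRadius k n) :
    ∃ H : G.Subgraph, H.coe.IsCritical k ∧
      ∃ A : SimpleGraph.PathAttachment H, H.coe.IsIndepSet A.nontrivialVerts := by
  have := hG.1.connected.nonempty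
  have hk := DistanceSpectral.ne_zero_of_chromaticNumber_eq hG.1.chromaticNumber_eq
  obtain ⟨H, hH, hind⟩ := DistanceSpectral.exists_isCritical_of_maximizes hk hG
  have hconn : H.Connected := ⟨DistanceSpectral.connected_of_isCritical hk hH⟩
  have hext := DistanceSpectral.isExtremalOver_of_maximizes hG hH.1
  obtain ⟨A⟩ := (hext.hasPathBranches hconn).nonempty_pathAttachment
  exact ⟨H, hH, A, fun u hu v hv _ huv =>
    hind huv (DistanceSpectral.hasBranchAt_of_mem_nontrivialVerts A hu)
      (DistanceSpectral.hasBranchAt_of_mem_nontrivialVerts A hv)⟩
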